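/- Let $C\subset\mathbb R^2$ be a convex set, with the topology induced from the plane. Let $\exp(C)$ be the set of all nonempty compact subsets of $C$ with the Vietoris topology, that is, the topology with subbase consisting of the sets $\{K\in\exp(C):K\subset U\}$ and $\{K\in\exp(C):K\cap U\neq\emptyset\}$, where $U$ runs over the open subsets of $C$. Then $C$ is compactly convex: there exists a continuous map $\Phi:C\to\exp(C)$ such that $$[x,y]\subset\Phi(x)\cup\Phi(y)\qquad\text{for all }x,y\in C,$$ where $[x,y]=\{(1-t)x+ty:0\le t\le 1\}$. -/

import Mathlib

/-- A subset `C` of a real topological vector space is compactly convex if it is convex and there is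
a map `Φ` from `C` to the hyperspace of nonempty compact subsets of `C`, continuous for the
Vietoris topology (this is the topology that Mathlib puts on `NonemptyCompacts`), such that
`[x, y] ⊆ Φ x ∪ Φ y` for all `x, y ∈ C`. -/
def IsCompactlyConvex {E : Type*} [AddCommGroup E] [Module ℝ E] [TopologicalSpace E]
    (C : Set E) : Prop :=
  Convex ℝ C ∧ ∃ Φ : C → TopologicalSpace.NonemptyCompacts C, Continuous Φ ∧
    ∀ x y : C, segment ℝ (x : E) (y : E) ⊆
      (Subtype.val '' (Φ x : Set C)) ∪ (Subtype.val '' (Φ y : Set C))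

/-!
Pass to the cone `K` over `C × {1}` in `E × ℝ`, which has dimension at most three. On the segment
joining two independent vectors `u`, `v` of the closure of `K`, at least one of them in `K`, a point
of `K` can be chosen continuously near any given pair `(u₀, v₀)`: take a plane supporting `K` at
`u₀ + v₀`, if this is not an interior point. A nearby pair either has `u + v` in the interior of
`K`, and then every point strictly between `u` and `v` is in `K`, or lies in that plane, where a
positive combination of two independent vectors of `K` stays one under small perturbations. Since
the admissible parameters on each segment form a convex set, a partition of unity glues the local
choices, and averaging makes them symmetric, `M (u, v) = M (v, u)`. At the diagonal `M` is
continuous because the segments shrink to a point.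

For `x ∈ C` with unit lift `u`, let `Φ x` be the projection to `E` of the union of the segments
`[u, M (u, v)]`, where `v` runs over the compact set of unit vectors of the closed cone. If `v` is
the lift of `y`, the segment `[x, y]` is split by the projection of `M (u, v)` into a part in `Φ x`
and a part in `Φ y`.
-/

open Set Filter Topology

section TopologicalCone

variable {V : Type*} [AddCommGroup V] [Module ℝ V] [TopologicalSpace V] [ContinuousSMul ℝ V]
  {K : ConvexCone ℝ V}

theorem smul_mem_interior_convexCone {c : ℝ} (hc : 0 < c) {x : V}
    (hx : x ∈ interior (K : Set V)) : c • x ∈ interior (K : Set V) := by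
  open scoped Pointwise in
  have hsub : c • (K : Set V) ⊆ K := smul_set_subset_iff.2 fun _ hy => K.smul_mem hc hy
  exact interior_mono hsub (interior_smul₀ hc.ne' (K : Set V) ▸ smul_mem_smul_set hx)

variable [IsTopologicalAddGroup V]

theorem add_mem_interior_convexCone {x y : V} (hx : x ∈ interior (K : Set V))
    (hy : y ∈ closure (K : Set V)) : x + y ∈ interior (K : Set V) := by
  have hmid := K.convex.combo_interior_closure_mem_interior hx hy
    (one_half_pos (α := ℝ)) one_half_pos.le (add_halves 1)
  convert smul_mem_interior_convexCone two_pos hmid using 1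
  module

theorem smul_add_smul_mem_interior_convexCone {x y : V} (hx : x ∈ closure (K : Set V))
    (hy : y ∈ closure (K : Set V)) (hxy : x + y ∈ interior (K : Set V)) {a b : ℝ} (ha : 0 < a)
    (hb : 0 < b) : a • x + b • y ∈ interior (K : Set V) := by
  obtain ⟨c, hc, hca, hcb⟩ : ∃ c > 0, c < a ∧ c < b :=
    (exists_between (lt_min ha hb)).imp fun _ h => ⟨h.1, lt_min_iff.1 h.2⟩
  have hrest : (a - c) • x + (b - c) • y ∈ K.closure :=
    K.closure.add_mem (K.closure.smul_mem (sub_pos.2 hca) hx)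
      (K.closure.smul_mem (sub_pos.2 hcb) hy)
  convert add_mem_interior_convexCone (smul_mem_interior_convexCone hc hxy) hrest using 1
  module

theorem exists_forall_mem_interior_nonpos_and_lt {q w : V}
    (hq : q ∈ interior (K : Set V)) (hw : w ∉ interior (K : Set V)) :
    ∃ g : V →L[ℝ] ℝ, (∀ x ∈ interior (K : Set V), g x ≤ 0 ∧ g x < g w) ∧ 0 ≤ g w := by
  obtain ⟨g, hg⟩ := geometric_hahn_banach_open_point K.convex.interior isOpen_interior hw
  have hscale : ∀ x ∈ interior (K : Set V), ∀ t : ℝ, 0 < t → t * g x < g w := fun x hx t ht => by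
    simpa using hg _ (smul_mem_interior_convexCone ht hx)
  refine ⟨g, fun x hx => ⟨?_, hg x hx⟩, ?_⟩
  · by_contra! hpos
    have := hscale x hx (g w / g x) (div_pos (hpos.trans (hg x hx)) hpos)
    exact this.ne (div_mul_cancel₀ _ hpos.ne')
  · by_contra! hneg
    have hgq := (hg q hq).trans hneg
    have := hscale q hq (g w / g q) (div_pos_of_neg_of_neg hneg hgq)
    exact this.ne (div_mul_cancel₀ _ hgq.ne)

end TopologicalCone

section SupportingFunctional

variable {V : Type*} [NormedAddCommGroup V] [NormedSpace ℝ V] {K : ConvexCone ℝ V}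

/-- `ℓ` is a supporting functional of the cone `K` at `w`. When `K` has no interior point, `ℓ` is
required to vanish on all of `K`. -/
structure SupportsAt (K : ConvexCone ℝ V) (ℓ : V →L[ℝ] ℝ) (w : V) : Prop where
  ne_zero : ℓ ≠ 0
  map_eq_zero : ℓ w = 0
  nonneg : ∀ x ∈ closure (K : Set V), 0 ≤ ℓ x
  pos : ∀ x ∈ interior (K : Set V), 0 < ℓ x
  eq_zero : interior (K : Set V) = ∅ → ∀ x ∈ closure (K : Set V), ℓ x = 0

theorem exists_ne_zero_forall_closure_eq_zero [FiniteDimensional ℝ V]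
    (hne : (K : Set V).Nonempty) (hint : interior (K : Set V) = ∅) :
    ∃ ℓ : V →L[ℝ] ℝ, ℓ ≠ 0 ∧ ∀ x ∈ closure (K : Set V), ℓ x = 0 := by
  have hspan : affineSpan ℝ (K : Set V) ≠ ⊤ := fun h =>
    (K.convex.interior_nonempty_iff_affineSpan_eq_top.2 h).ne_empty hint
  have hdir : vectorSpan ℝ (K : Set V) < ⊤ := by
    rwa [lt_top_iff_ne_top, ← direction_affineSpan, Ne,
      AffineSubspace.direction_eq_top_iff_of_nonempty ((affineSpan_nonempty ℝ).2 hne)]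
  obtain ⟨f, hf, hker⟩ := Submodule.exists_le_ker_of_lt_top _ hdir
  refine ⟨f.toContinuousLinearMap, by simpa using hf, ?_⟩
  refine fun x hx => closure_minimal (t := {x | f.toContinuousLinearMap x = 0}) (fun y hy => ?_)
    (isClosed_singleton.preimage f.toContinuousLinearMap.continuous) hx
  have hdiff := hker (vsub_mem_vectorSpan ℝ (K.smul_mem two_pos hy) hy)
  simpa [two_smul] using hdiff

theorem exists_supportsAt [FiniteDimensional ℝ V] {w : V} (hw : w ∈ closure (K : Set V))
    (hint : w ∉ interior (K : Set V)) : ∃ ℓ, SupportsAt K ℓ w := by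
  rcases (interior (K : Set V)).eq_empty_or_nonempty with hempty | ⟨q, hq⟩
  · obtain ⟨ℓ, hℓ, hzero⟩ :=
      exists_ne_zero_forall_closure_eq_zero (closure_nonempty_iff.1 ⟨w, hw⟩) hempty
    exact ⟨ℓ, hℓ, hzero w hw, fun x hx => (hzero x hx).ge, by simp [hempty], fun _ => hzero⟩
  · obtain ⟨g, hg, hgw⟩ := exists_forall_mem_interior_nonpos_and_lt hq hint
    have hcl : ∀ x ∈ closure (K : Set V), g x ≤ 0 := by
      rw [← K.convex.closure_interior_eq_closure_of_nonempty_interior ⟨q, hq⟩]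
      exact fun x hx => closure_minimal (fun y hy => (hg y hy).1)
        (isClosed_Iic.preimage g.continuous) hx
    have hgw0 : g w = 0 := (hcl w hw).antisymm hgw
    have hneg : ∀ x ∈ interior (K : Set V), g x < 0 := fun x hx => hgw0 ▸ (hg x hx).2
    exact ⟨-g, fun h => (hneg q hq).ne (by simpa using DFunLike.congr_fun h q), by simpa using hgw0,
      fun x hx => by simpa using hcl x hx, fun x hx => by simpa using hneg x hx,
      fun h => absurd hq (by simp [h])⟩

end SupportingFunctional

section LocalSelection

variable {V : Type*} [NormedAddCommGroup V] [NormedSpace ℝ V]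

theorem eventually_exists_pos_smul_add_smul_eq [FiniteDimensional ℝ V] {W : Submodule ℝ V}
    (hW : Module.finrank ℝ W ≤ 2) {x y : V} (hx : x ∈ W) (hy : y ∈ W)
    (hxy : LinearIndependent ℝ ![x, y]) {s t : ℝ} (hs : 0 < s) (ht : 0 < t) :
    ∀ᶠ w in 𝓝 (s • x + t • y), w ∈ W → ∃ s' t' : ℝ, 0 < s' ∧ 0 < t' ∧ s' • x + t' • y = w := by
  have hspan : Submodule.span ℝ {x, y} = W := by
    refine Submodule.eq_of_le_of_finrank_le
      (Submodule.span_le.2 (by simp [insert_subset_iff, *])) ?_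
    rw [← Matrix.range_cons_cons_empty x y ![], finrank_span_eq_card hxy, Fintype.card_fin]
    exact hW
  obtain ⟨coords, hcoords⟩ := LinearMap.exists_leftInverse_of_injective
    ((LinearMap.fst ℝ ℝ ℝ).smulRight x + (LinearMap.snd ℝ ℝ ℝ).smulRight y) <|
    (LinearMap.ker_eq_bot').2 fun p hp => Prod.ext_iff.2 <| LinearIndependent.pair_iff.1 hxy _ _ hp
  have hcoords' : ∀ a b : ℝ, coords (a • x + b • y) = (a, b) := fun a b =>
    LinearMap.congr_fun hcoords (a, b)
  have hpos : ∀ᶠ w in 𝓝 (s • x + t • y), coords w ∈ Ioi (0 : ℝ) ×ˢ Ioi (0 : ℝ) :=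
    coords.continuous_of_finiteDimensional.continuousAt.eventually_mem <|
      (isOpen_Ioi.prod isOpen_Ioi).mem_nhds (by simp [-map_add, hcoords', hs, ht])
  filter_upwards [hpos] with w hw hwW
  obtain ⟨a, b, rfl⟩ := Submodule.mem_span_pair.1 (hspan ▸ hwW)
  rw [hcoords'] at hw
  exact ⟨a, b, hw.1, hw.2, rfl⟩

namespace SupportsAt

variable {K : ConvexCone ℝ V} {ℓ : V →L[ℝ] ℝ}

theorem map_left_eq_zero {u v : V} (hℓ : SupportsAt K ℓ (u + v)) (hu : u ∈ closure (K : Set V))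
    (hv : v ∈ closure (K : Set V)) : ℓ u = 0 := by
  have := hℓ.map_eq_zero
  rw [map_add] at this
  linarith [hℓ.nonneg u hu, hℓ.nonneg v hv]

theorem map_right_eq_zero {u v : V} (hℓ : SupportsAt K ℓ (u + v)) (hu : u ∈ closure (K : Set V))
    (hv : v ∈ closure (K : Set V)) : ℓ v = 0 :=
  (add_comm u v ▸ hℓ).map_left_eq_zero hv hu

theorem finrank_ker_le_two [FiniteDimensional ℝ V] {w : V} (hℓ : SupportsAt K ℓ w)
    (hV : Module.finrank ℝ V ≤ 3) : Module.finrank ℝ ℓ.ker ≤ 2 := by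
  have := Module.Dual.finrank_ker_add_one_of_ne_zero
    (f := (ℓ : V →ₗ[ℝ] ℝ)) (mod_cast hℓ.ne_zero)
  exact Nat.le_of_succ_le_succ (this.trans_le hV)

theorem eventually_exists_pos [FiniteDimensional ℝ V] {w : V} (hℓ : SupportsAt K ℓ w)
    (hV : Module.finrank ℝ V ≤ 3) {x y : V} (hx : ℓ x = 0) (hy : ℓ y = 0)
    (hxy : LinearIndependent ℝ ![x, y]) {s t : ℝ} (hs : 0 < s) (ht : 0 < t) :
    ∀ᶠ z in 𝓝 (s • x + t • y), ℓ z = 0 → ∃ s' t' : ℝ, 0 < s' ∧ 0 < t' ∧ s' • x + t' • y = z :=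
  eventually_exists_pos_smul_add_smul_eq (hℓ.finrank_ker_le_two hV) hx hy hxy hs ht

theorem eventually_mem_interior [FiniteDimensional ℝ V] {u v : V} (hℓ : SupportsAt K ℓ (u + v))
    (hV : Module.finrank ℝ V ≤ 3) (hu : u ∈ closure (K : Set V)) (hv : v ∈ closure (K : Set V))
    (huv : LinearIndependent ℝ ![u, v]) :
    ∀ᶠ w in 𝓝 (u + v), w ∈ closure (K : Set V) → 0 < ℓ w → w ∈ interior (K : Set V) := by
  rcases (interior (K : Set V)).eq_empty_or_nonempty with hempty | ⟨q, hq⟩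
  · exact .of_forall fun w hw hpos => absurd (hℓ.eq_zero hempty w hw) hpos.ne'
  have hℓq := hℓ.pos q hq
  let proj : V → V := fun w => w - (ℓ w / ℓ q) • q
  have hproj : Tendsto proj (𝓝 (u + v)) (𝓝 ((1 : ℝ) • u + (1 : ℝ) • v)) := by
    have : Continuous proj := by fun_prop
    simpa [proj, hℓ.map_eq_zero, -map_add] using this.tendsto (u + v)
  filter_upwards [hproj.eventually (hℓ.eventually_exists_pos hV (hℓ.map_left_eq_zero hu hv)
    (hℓ.map_right_eq_zero hu hv) huv one_pos one_pos)] with w hw _ hpos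
  obtain ⟨s, t, hs, ht, hst⟩ := hw (by simp [proj, hℓq.ne'])
  have hmem : s • u + t • v ∈ K.closure :=
    K.closure.add_mem (K.closure.smul_mem hs hu) (K.closure.smul_mem ht hv)
  convert add_mem_interior_convexCone
    (smul_mem_interior_convexCone (div_pos hpos hℓq) hq) hmem using 1
  rw [hst, add_sub_cancel]

theorem eventually_mem_interior_or_map_eq_zero [FiniteDimensional ℝ V] {u v : V}
    (hℓ : SupportsAt K ℓ (u + v)) (hV : Module.finrank ℝ V ≤ 3)
    (hu : u ∈ closure (K : Set V)) (hv : v ∈ closure (K : Set V))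
    (huv : LinearIndependent ℝ ![u, v]) :
    ∀ᶠ p in 𝓝 (u, v), p.1 ∈ closure (K : Set V) → p.2 ∈ closure (K : Set V) →
      (0 < ℓ (p.1 + p.2) ∧ p.1 + p.2 ∈ interior (K : Set V)) ∨ (ℓ p.1 = 0 ∧ ℓ p.2 = 0) := by
  filter_upwards [(continuous_add.tendsto (u, v)).eventually
    (hℓ.eventually_mem_interior hV hu hv huv)] with p hp h₁ h₂
  have hsum : p.1 + p.2 ∈ closure (K : Set V) := K.closure.add_mem h₁ h₂
  rcases (hℓ.nonneg _ hsum).lt_or_eq with hpos | hzero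
  · exact .inl ⟨hpos, hp hsum hpos⟩
  · rw [map_add] at hzero
    have := hℓ.nonneg _ h₁
    have := hℓ.nonneg _ h₂
    exact .inr ⟨by linarith, by linarith⟩

end SupportsAt

/-- The parameters `t ∈ [0, 1]` for which the point `(1 - t) u + t v` of the segment `[u, v]`,
`p = (u, v)`, lies in the cone. -/
def conicParams (K : ConvexCone ℝ V) (p : V × V) : Set ℝ :=
  {t | t ∈ Icc 0 1 ∧ AffineMap.lineMap p.1 p.2 t ∈ K}

/-- The linearly independent pairs in the closure of the cone with at least one entry in the cone;
the second condition makes the set of parameters nonempty. -/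
def independentPairs (K : ConvexCone ℝ V) : Set (V × V) :=
  {p | p.1 ∈ closure (K : Set V) ∧ p.2 ∈ closure (K : Set V) ∧ (p.1 ∈ K ∨ p.2 ∈ K) ∧
    LinearIndependent ℝ ![p.1, p.2]}

/-- A continuous choice of conic parameters near the pair `p`. -/
def HasLocalSelection (K : ConvexCone ℝ V) (p : V × V) : Prop :=
  ∃ g : V × V → ℝ, Continuous g ∧ ∀ᶠ q in 𝓝 p, q ∈ independentPairs K → g q ∈ conicParams K q

variable {K : ConvexCone ℝ V}

theorem convex_conicParams (p : V × V) : Convex ℝ (conicParams K p) :=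
  (convex_Icc 0 1).inter (K.convex.affine_preimage _)

theorem mem_conicParams_of_add_mem_interior {p : V × V} (h₁ : p.1 ∈ closure (K : Set V))
    (h₂ : p.2 ∈ closure (K : Set V)) (hp : p.1 + p.2 ∈ interior (K : Set V)) {t : ℝ}
    (ht : t ∈ Ioo 0 1) : t ∈ conicParams K p := by
  refine ⟨Ioo_subset_Icc_self ht, interior_subset ?_⟩
  rw [AffineMap.lineMap_apply_module]
  exact smul_add_smul_mem_interior_convexCone h₁ h₂ hp (sub_pos.2 ht.2) ht.1

theorem swap_mem_independentPairs {p : V × V} (hp : p ∈ independentPairs K) :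
    p.swap ∈ independentPairs K :=
  ⟨hp.2.1, hp.1, hp.2.2.1.symm, LinearIndependent.pair_symm_iff.1 hp.2.2.2⟩

theorem one_sub_mem_conicParams {p : V × V} {t : ℝ} (ht : t ∈ conicParams K p.swap) :
    1 - t ∈ conicParams K p := by
  refine ⟨⟨sub_nonneg.2 ht.1.2, sub_le_self _ ht.1.1⟩, ?_⟩
  rw [AffineMap.lineMap_apply_one_sub]
  exact ht.2

theorem HasLocalSelection.of_swap {p : V × V} (h : HasLocalSelection K p.swap) :
    HasLocalSelection K p := by
  obtain ⟨g, hg, hgK⟩ := h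
  refine ⟨fun q => 1 - g q.swap, by fun_prop, ?_⟩
  filter_upwards [(continuous_swap.tendsto p).eventually hgK] with q hq hqP
  exact one_sub_mem_conicParams (hq (swap_mem_independentPairs hqP))

theorem hasLocalSelection_of_add_mem_interior {p : V × V}
    (hp : p.1 + p.2 ∈ interior (K : Set V)) : HasLocalSelection K p := by
  refine ⟨fun _ => 1 / 2, continuous_const, ?_⟩
  filter_upwards [continuous_add.continuousAt.eventually_mem (isOpen_interior.mem_nhds hp)]
    with q hq hqP
  exact mem_conicParams_of_add_mem_interior hqP.1 hqP.2.1 hq ⟨by norm_num, by norm_num⟩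

theorem SupportsAt.hasLocalSelection_of_pos_mem [FiniteDimensional ℝ V] {ℓ : V →L[ℝ] ℝ} {p : V × V}
    (hℓ : SupportsAt K ℓ (p.1 + p.2)) (hV : Module.finrank ℝ V ≤ 3) (hp : p ∈ independentPairs K)
    (h₁ : p.1 ∈ K) {r : ℝ} (hr : r ∈ conicParams K p) (hr0 : 0 < r) : HasLocalSelection K p := by
  obtain ⟨hp₁, hp₂, -, hind⟩ := hp
  have hℓ₁ := hℓ.map_left_eq_zero hp₁ hp₂
  have hℓ₂ := hℓ.map_right_eq_zero hp₁ hp₂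
  set k := AffineMap.lineMap p.1 p.2 r with hk
  have hkK : k ∈ K := hr.2
  rw [AffineMap.lineMap_apply_module] at hk
  have hℓk : ℓ k = 0 := by simp [hk, hℓ₁, hℓ₂]
  have hind' : LinearIndependent ℝ ![p.1, k] := by
    rw [LinearIndependent.pair_iff] at hind ⊢
    intro s t hst
    have := hind (s + t * (1 - r)) (t * r) (by rw [← hst, hk]; module)
    have ht : t = 0 := by simpa [hr0.ne'] using this.2
    simpa [ht] using this
  have hmid : AffineMap.lineMap p.1 p.2 (r / 2) = (1 / 2 : ℝ) • p.1 + (1 / 2 : ℝ) • k := by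
    rw [AffineMap.lineMap_apply_module, hk]
    module
  have hcont : Continuous fun q : V × V => AffineMap.lineMap (k := ℝ) q.1 q.2 (r / 2) := by fun_prop
  refine ⟨fun _ => r / 2, continuous_const, ?_⟩
  have hplane := hℓ.eventually_exists_pos hV hℓ₁ hℓk hind' one_half_pos one_half_pos
  rw [← hmid] at hplane
  filter_upwards [hℓ.eventually_mem_interior_or_map_eq_zero hV hp₁ hp₂ hind,
    (hcont.tendsto p).eventually hplane] with q hq hqplane hqP
  rcases hq hqP.1 hqP.2.1 with ⟨-, hint⟩ | ⟨hq₁, hq₂⟩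
  · exact mem_conicParams_of_add_mem_interior hqP.1 hqP.2.1 hint
      ⟨half_pos hr0, by linarith [hr.1.2]⟩
  · obtain ⟨s, t, hs, ht, hst⟩ := hqplane (by simp [AffineMap.lineMap_apply_module, hq₁, hq₂])
    refine ⟨⟨(half_pos hr0).le, by linarith [hr.1.2]⟩, ?_⟩
    rw [← hst]
    exact K.add_mem (K.smul_mem hs h₁) (K.smul_mem ht hkK)

theorem exists_pos_mem_conicParams {p : V × V} {s t : ℝ} (hs : 0 < s) (ht : 0 < t)
    (h : s • p.1 + t • p.2 ∈ K) : ∃ r ∈ conicParams K p, 0 < r := by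
  refine ⟨t / (s + t), ⟨⟨by positivity, div_le_one_of_le₀ (by linarith) (by positivity)⟩, ?_⟩,
    by positivity⟩
  have hst : s + t ≠ 0 := by positivity
  convert K.smul_mem (inv_pos.2 (add_pos hs ht)) h using 1
  rw [AffineMap.lineMap_apply_module, one_sub_div hst]
  match_scalars
  · field_simp
    ring
  · field_simp

theorem SupportsAt.hasLocalSelection_of_forall_le [FiniteDimensional ℝ V] {ℓ : V →L[ℝ] ℝ}
    {p : V × V} (hℓ : SupportsAt K ℓ (p.1 + p.2)) (hV : Module.finrank ℝ V ≤ 3)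
    (hp : p ∈ independentPairs K) (h₁ : p.1 ∈ K)
    (hr : ∀ r ∈ conicParams K p, r ≤ 0) : HasLocalSelection K p := by
  obtain ⟨hp₁, hp₂, -, hind⟩ := hp
  have hℓ₁ := hℓ.map_left_eq_zero hp₁ hp₂
  have hℓ₂ := hℓ.map_right_eq_zero hp₁ hp₂
  have hplane : ∀ᶠ w in 𝓝 (p.1 + p.2), ℓ w = 0 → w ∉ K := by
    have := hℓ.eventually_exists_pos hV hℓ₁ hℓ₂ hind one_pos one_pos
    rw [one_smul, one_smul] at this
    filter_upwards [this] with w hw hℓw hwK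
    obtain ⟨s, t, hs, ht, rfl⟩ := hw hℓw
    obtain ⟨r, hrK, hr0⟩ := exists_pos_mem_conicParams hs ht hwK
    exact (hr r hrK).not_gt hr0
  have hcont : Continuous fun q : V × V => p.1 + q.2 := by fun_prop
  -- Pairs in the supporting plane may admit only the parameter `0`; off it, all of `(0, 1)` works.
  refine ⟨fun q => min (1 / 2) (ℓ (q.1 + q.2)), by fun_prop, ?_⟩
  filter_upwards [hℓ.eventually_mem_interior_or_map_eq_zero hV hp₁ hp₂ hind,
    (hcont.tendsto p).eventually hplane] with q hq hqplane hqP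
  rcases hq hqP.1 hqP.2.1 with ⟨hpos, hint⟩ | ⟨hq₁, hq₂⟩
  · exact mem_conicParams_of_add_mem_interior hqP.1 hqP.2.1 hint
      ⟨lt_min one_half_pos hpos, (min_le_left _ _).trans_lt one_half_lt_one⟩
  · have hqK : q.1 ∈ K := hqP.2.2.1.resolve_right fun h =>
      hqplane (by simp [hℓ₁, hq₂]) (K.add_mem h₁ h)
    rw [map_add, hq₁, hq₂, add_zero, min_eq_right one_half_pos.le]
    exact ⟨left_mem_Icc.2 zero_le_one, by simpa using hqK⟩

theorem hasLocalSelection [FiniteDimensional ℝ V] (hV : Module.finrank ℝ V ≤ 3) {p : V × V}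
    (hp : p ∈ independentPairs K) : HasLocalSelection K p := by
  wlog h₁ : p.1 ∈ K generalizing p
  · exact .of_swap (this (swap_mem_independentPairs hp) (hp.2.2.1.resolve_left h₁))
  by_cases hint : p.1 + p.2 ∈ interior (K : Set V)
  · exact hasLocalSelection_of_add_mem_interior hint
  obtain ⟨ℓ, hℓ⟩ := exists_supportsAt (K.closure.add_mem hp.1 hp.2.1) hint
  by_cases hr : ∀ r ∈ conicParams K p, r ≤ 0
  · exact hℓ.hasLocalSelection_of_forall_le hV hp h₁ hr
  · push Not at hr
    obtain ⟨r, hr, hr0⟩ := hr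
    exact hℓ.hasLocalSelection_of_pos_mem hV hp h₁ hr hr0

end LocalSelection

section GlobalSelection

theorem exists_continuousOn_forall_mem_convex_of_local {X F : Type*}
    [TopologicalSpace X] [AddCommGroup F] [Module ℝ F] [TopologicalSpace F] [ContinuousAdd F]
    [ContinuousSMul ℝ F] {s : Set X} [NormalSpace s] [ParacompactSpace s] {t : X → Set F}
    (ht : ∀ x ∈ s, Convex ℝ (t x))
    (hlocal : ∀ x ∈ s, ∃ g : X → F, Continuous g ∧ ∀ᶠ y in 𝓝 x, y ∈ s → g y ∈ t y) :
    ∃ f : X → F, ContinuousOn f s ∧ ∀ x ∈ s, f x ∈ t x := by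
  obtain ⟨f, hf⟩ := exists_continuous_forall_mem_convex_of_local (X := s) (t := fun x => t x)
    (fun x => ht x x.2) fun x => by
      obtain ⟨g, hg, hgt⟩ := hlocal x x.2
      refine ⟨{y | g y ∈ t y}, ?_, fun y => g y, by fun_prop, fun y hy => hy⟩
      filter_upwards [continuous_subtype_val.continuousAt.eventually hgt] with y hy using hy y.2
  have hext : ∀ x : s, Function.extend Subtype.val f 0 x.1 = f x :=
    Subtype.val_injective.extend_apply f 0
  refine ⟨Function.extend Subtype.val f 0, ?_, fun x hx => hext ⟨x, hx⟩ ▸ hf ⟨x, hx⟩⟩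
  rw [continuousOn_iff_continuous_domRestrict]
  exact f.continuous.congr fun x => (hext x).symm

variable {V : Type*} [NormedAddCommGroup V] [NormedSpace ℝ V] {K : ConvexCone ℝ V}

/-- A continuous symmetric choice of a point of the cone on the segment joining an independent
pair. The diagonal, where the chosen point is the common entry, is included among the segments so
that the choice extends continuously to it. -/
structure IsSymmetricSelection (K : ConvexCone ℝ V) (M : V × V → V) : Prop where
  map_swap : ∀ p, M p.swap = M p
  mem_segment : ∀ p ∈ independentPairs K ∪ diagonal V, M p ∈ segment ℝ p.1 p.2
  mem_cone : ∀ p ∈ independentPairs K, M p ∈ K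
  continuousOn : ContinuousOn M (independentPairs K)

theorem exists_isSymmetricSelection [FiniteDimensional ℝ V] (hV : Module.finrank ℝ V ≤ 3) :
    ∃ M, IsSymmetricSelection K M := by
  obtain ⟨τ, hτc, hτ⟩ := exists_continuousOn_forall_mem_convex_of_local
    (fun p _ => convex_conicParams (K := K) p) fun _ => hasLocalSelection hV
  let σ : V × V → ℝ := fun p => (1 / 2 : ℝ) • τ p + (1 / 2 : ℝ) • (1 - τ p.swap)
  have hσ : ∀ p ∈ independentPairs K, σ p ∈ conicParams K p := fun p hp =>
    convex_conicParams p (hτ p hp)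
      (one_sub_mem_conicParams (hτ p.swap (swap_mem_independentPairs hp)))
      one_half_pos.le one_half_pos.le (add_halves 1)
  have hσ_swap : ∀ p, σ p.swap = 1 - σ p := fun p => by
    simp only [σ, Prod.swap_swap, smul_eq_mul]
    ring
  have hτ_swap : ContinuousOn (fun p => τ p.swap) (independentPairs K) :=
    hτc.comp continuous_swap.continuousOn fun p => swap_mem_independentPairs
  have hσc : ContinuousOn σ (independentPairs K) :=
    (hτc.const_smul (1 / 2 : ℝ)).add ((continuousOn_const.sub hτ_swap).const_smul (1 / 2 : ℝ))
  refine ⟨fun p => AffineMap.lineMap p.1 p.2 (σ p), fun p => ?_, ?_, fun p hp => (hσ p hp).2, ?_⟩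
  · rw [hσ_swap, Prod.fst_swap, Prod.snd_swap, AffineMap.lineMap_apply_one_sub]
  · rintro ⟨u, v⟩ (hp | rfl : _ ∨ u = v)
    · exact segment_eq_image_lineMap ℝ u v ▸ mem_image_of_mem _ (hσ _ hp).1
    · simp
  · exact continuousOn_fst.lineMap continuousOn_snd hσc

namespace IsSymmetricSelection

variable {M : V × V → V}

theorem map_diag (hM : IsSymmetricSelection K M) (u : V) : M (u, u) = u := by
  simpa using hM.mem_segment (u, u) (.inr rfl)

theorem continuousWithinAt_diag (hM : IsSymmetricSelection K M) (u : V) :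
    ContinuousWithinAt M (independentPairs K ∪ diagonal V) (u, u) := by
  rw [ContinuousWithinAt, hM.map_diag, tendsto_iff_dist_tendsto_zero]
  have hbound : ∀ p ∈ independentPairs K ∪ diagonal V,
      dist (M p) u ≤ dist p.1 p.2 + dist p.1 u := fun p hp => by
    have hsplit := dist_add_dist_of_mem_segment (hM.mem_segment p hp)
    linarith [dist_triangle_left (M p) u p.1, dist_nonneg (x := M p) (y := p.2)]
  have hcont : Continuous fun p : V × V => dist p.1 p.2 + dist p.1 u := by fun_prop
  refine squeeze_zero' (.of_forall fun _ => dist_nonneg)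
    (eventually_mem_nhdsWithin.mono hbound) ?_
  simpa using (hcont.tendsto (u, u)).mono_left nhdsWithin_le_nhds

theorem continuousOn_union_diagonal (hM : IsSymmetricSelection K M) :
    ContinuousOn M (independentPairs K ∪ diagonal V) := by
  rintro ⟨u, v⟩ hp
  rcases eq_or_ne u v with rfl | hne
  · exact hM.continuousWithinAt_diag u
  · have hnotMem : (u, v) ∉ diagonal V := hne
    exact (hM.continuousOn _ (hp.resolve_right hnotMem)).union
      (continuousWithinAt_of_notMem_closure (by rwa [isClosed_diagonal.closure_eq]))

end IsSymmetricSelection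

end GlobalSelection

section Homogenization

theorem segment_subset_union_segment {E : Type*} [AddCommGroup E] [Module ℝ E] {x y m : E}
    (hm : m ∈ segment ℝ x y) : segment ℝ x y ⊆ segment ℝ x m ∪ segment ℝ m y := by
  rw [segment_eq_image_lineMap] at hm ⊢
  obtain ⟨s, hs, rfl⟩ := hm
  rintro _ ⟨t, ht, rfl⟩
  have himage : ∀ a b : ℝ, AffineMap.lineMap x y '' segment ℝ a b =
      segment ℝ (AffineMap.lineMap x y a) (AffineMap.lineMap x y b) := image_segment ℝ _
  have h₀ := himage 0 s
  have h₁ := himage s 1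
  rw [AffineMap.lineMap_apply_zero, segment_eq_Icc hs.1] at h₀
  rw [AffineMap.lineMap_apply_one, segment_eq_Icc hs.2] at h₁
  rw [← h₀, ← h₁]
  exact (le_total t s).imp (fun h => mem_image_of_mem _ ⟨ht.1, h⟩)
    fun h => mem_image_of_mem _ ⟨h, ht.2⟩

section Algebraic

variable {E : Type*} [AddCommGroup E] [Module ℝ E] {C : Set E}

/-- The convex cone in `E × ℝ` spanned by a copy of `C` at height `1`. -/
def homogenization (C : Set E) : ConvexCone ℝ (E × ℝ) :=
  ConvexCone.hull ℝ (C ×ˢ {1})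

/-- The central projection of `E × ℝ` to `E`, identified with the affine subspace at height `1`;
its value at height `0` is junk. -/
noncomputable def dehomogenize (p : E × ℝ) : E :=
  p.2⁻¹ • p.1

theorem mem_homogenization_iff (hC : Convex ℝ C) {p : E × ℝ} :
    p ∈ homogenization C ↔ 0 < p.2 ∧ dehomogenize p ∈ C := by
  rw [homogenization, ConvexCone.mem_hull_of_convex (hC.prod (convex_singleton 1))]
  constructor
  · rintro ⟨c, hc, ⟨y, _⟩, ⟨hy, rfl⟩, rfl⟩
    simpa [dehomogenize, hc, smul_smul, hc.ne'] using hy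
  · rintro ⟨hp, hpC⟩
    exact ⟨p.2, hp, (dehomogenize p, 1), ⟨hpC, rfl⟩, by ext <;> simp [dehomogenize, hp.ne']⟩

theorem segment_dehomogenize_subset {u v : E × ℝ} (hu : 0 < u.2) (hv : 0 < v.2) :
    segment ℝ (dehomogenize u) (dehomogenize v) ⊆ dehomogenize '' segment ℝ u v := by
  rintro _ ⟨a, b, ha, hb, hab, rfl⟩
  have hpos : 0 < a / u.2 + b / v.2 := by
    rcases ha.eq_or_lt with rfl | ha
    · rw [zero_add] at hab
      subst hab
      positivity
    · positivity
  refine ⟨_, mem_segment_iff_div.2 ⟨a / u.2, b / v.2, by positivity, by positivity, hpos, rfl⟩, ?_⟩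
  generalize a / u.2 + b / v.2 = S at hpos ⊢
  simp only [dehomogenize, Prod.fst_add, Prod.snd_add, Prod.smul_fst, Prod.smul_snd, smul_eq_mul]
  match_scalars <;> (field_simp; rw [hab, mul_one])

end Algebraic

theorem norm_mk_one_pos {E : Type*} [NormedAddCommGroup E] (x : E) : 0 < ‖(x, (1 : ℝ))‖ :=
  norm_pos_iff.2 (by simp)

variable {E : Type*} [NormedAddCommGroup E] [NormedSpace ℝ E] {C : Set E}

theorem continuousOn_dehomogenize : ContinuousOn (dehomogenize (E := E)) {p | 0 < p.2} :=
  (continuousOn_snd.inv₀ fun _ hp => ne_of_gt hp).smul continuousOn_fst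

/-- The unit vector of `E × ℝ` on the ray over `x`. -/
noncomputable def unitLift (x : E) : E × ℝ :=
  ‖(x, (1 : ℝ))‖⁻¹ • (x, 1)

theorem norm_unitLift (x : E) : ‖unitLift x‖ = 1 :=
  norm_smul_inv_norm (𝕜 := ℝ) (by simp)

theorem continuous_unitLift : Continuous (unitLift (E := E)) := by
  have hcont : Continuous fun x : E => (x, (1 : ℝ)) := by fun_prop
  exact (hcont.norm.inv₀ fun x => (norm_mk_one_pos x).ne').smul hcont

theorem unitLift_snd_pos (x : E) : 0 < (unitLift x).2 := by
  simp [unitLift]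

theorem dehomogenize_unitLift (x : E) : dehomogenize (unitLift x) = x := by
  simp [dehomogenize, unitLift, smul_smul, -Prod.norm_mk, (norm_mk_one_pos x).ne']

theorem unitLift_mem_homogenization (hC : Convex ℝ C) {x : E} (hx : x ∈ C) :
    unitLift x ∈ homogenization C :=
  (mem_homogenization_iff hC).2 ⟨unitLift_snd_pos x, (dehomogenize_unitLift x).symm ▸ hx⟩

/-- The unit vectors in the closed cone over `C`. In finite dimension this is a compactification of
`C` by the points of its closure and the directions at infinity. -/
def unitDirections (C : Set E) : Set (E × ℝ) :=
  closure (homogenization C : Set (E × ℝ)) ∩ Metric.sphere 0 1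

theorem isCompact_unitDirections [FiniteDimensional ℝ E] : IsCompact (unitDirections C) :=
  have := FiniteDimensional.proper ℝ (E × ℝ)
  (isCompact_sphere _ _).inter_left isClosed_closure

theorem unitLift_mem_unitDirections (hC : Convex ℝ C) {x : E} (hx : x ∈ C) :
    unitLift x ∈ unitDirections C :=
  ⟨subset_closure (unitLift_mem_homogenization hC hx), by simp [norm_unitLift]⟩

theorem snd_nonneg_of_mem_unitDirections (hC : Convex ℝ C) {v : E × ℝ}
    (hv : v ∈ unitDirections C) : 0 ≤ v.2 :=
  closure_minimal (fun _ hp => ((mem_homogenization_iff hC).1 hp).1.le)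
    (isClosed_Ici.preimage continuous_snd) hv.1

theorem mk_unitLift_mem_independentPairs_union_diagonal (hC : Convex ℝ C) {x : E} (hx : x ∈ C)
    {v : E × ℝ} (hv : v ∈ unitDirections C) :
    (unitLift x, v) ∈ independentPairs (homogenization C) ∪ diagonal (E × ℝ) := by
  have hnorm : ‖unitLift x‖ = ‖v‖ := by rw [norm_unitLift, mem_sphere_zero_iff_norm.1 hv.2]
  have hxK := unitLift_mem_homogenization hC hx
  by_cases hind : LinearIndependent ℝ ![unitLift x, v]
  · exact .inl ⟨subset_closure hxK, hv.1, .inl hxK, hind⟩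
  refine .inr ?_
  rcases sameRay_or_sameRay_neg_iff_not_linearIndependent.2 hind with hray | hray
  · exact hray.eq_of_norm_eq hnorm
  · have hopp : unitLift x = -v := hray.eq_of_norm_eq (by rw [hnorm, norm_neg])
    have hpos := unitLift_snd_pos x
    rw [hopp, Prod.snd_neg] at hpos
    linarith [snd_nonneg_of_mem_unitDirections hC hv]

/-- The map whose range over `[0, 1]` times the unit directions is `Φ x`: it traces the projections
to `E` of the segments from the lift of `x` to the points selected by `M`. -/
noncomputable def fan (M : (E × ℝ) × (E × ℝ) → E × ℝ) (x : E) (z : ℝ × (E × ℝ)) : E :=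
  dehomogenize (AffineMap.lineMap (unitLift x) (M (unitLift x, z.2)) z.1)

namespace IsSymmetricSelection

variable {M : (E × ℝ) × (E × ℝ) → E × ℝ}

theorem lineMap_mem_homogenization (hM : IsSymmetricSelection (homogenization C) M)
    (hC : Convex ℝ C) {x : E} (hx : x ∈ C) {v : E × ℝ} (hv : v ∈ unitDirections C) {t : ℝ}
    (ht : t ∈ Icc 0 1) :
    AffineMap.lineMap (unitLift x) (M (unitLift x, v)) t ∈ homogenization C := by
  have hxK := unitLift_mem_homogenization hC hx
  refine (homogenization C).convex.lineMap_mem hxK ?_ ht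
  rcases mk_unitLift_mem_independentPairs_union_diagonal hC hx hv with hp | hp
  · exact hM.mem_cone _ hp
  · obtain rfl : unitLift x = v := hp
    rwa [hM.map_diag]

theorem continuous_fan (hM : IsSymmetricSelection (homogenization C) M) (hC : Convex ℝ C) :
    Continuous fun p : C × (Icc (0 : ℝ) 1 × unitDirections C) => fan M p.1 (p.2.1, p.2.2) := by
  have hlift : Continuous fun p : C × (Icc (0 : ℝ) 1 × unitDirections C) => unitLift (p.1 : E) :=
    continuous_unitLift.comp (by fun_prop)
  have hselect : Continuous fun p : C × (Icc (0 : ℝ) 1 × unitDirections C) =>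
      M (unitLift (p.1 : E), p.2.2) :=
    hM.continuousOn_union_diagonal.comp_continuous (by fun_prop) fun p =>
      mk_unitLift_mem_independentPairs_union_diagonal hC p.1.2 p.2.2.2
  exact continuousOn_dehomogenize.comp_continuous (hlift.lineMap hselect (by fun_prop)) fun p =>
    ((mem_homogenization_iff hC).1
      (hM.lineMap_mem_homogenization hC p.1.2 p.2.2.2 p.2.1.2)).1

theorem segment_subset_fan (hM : IsSymmetricSelection (homogenization C) M) (hC : Convex ℝ C)
    {x y : E} (hx : x ∈ C) (hy : y ∈ C) :
    segment ℝ x y ⊆ fan M x '' (Icc 0 1 ×ˢ unitDirections C) ∪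
      fan M y '' (Icc 0 1 ×ˢ unitDirections C) := by
  have hhalf : ∀ a b : E, b ∈ C →
      dehomogenize '' segment ℝ (unitLift a) (M (unitLift a, unitLift b)) ⊆
        fan M a '' (Icc 0 1 ×ˢ unitDirections C) := by
    intro a b hb
    rw [segment_eq_image_lineMap, image_image, image_subset_iff]
    exact fun t ht => ⟨(t, unitLift b), ⟨ht, unitLift_mem_unitDirections hC hb⟩, rfl⟩
  have hmem := hM.mem_segment _ <|
    mk_unitLift_mem_independentPairs_union_diagonal hC hx (unitLift_mem_unitDirections hC hy)
  have hswap : M (unitLift y, unitLift x) = M (unitLift x, unitLift y) :=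
    hM.map_swap (unitLift x, unitLift y)
  calc segment ℝ x y
      = segment ℝ (dehomogenize (unitLift x)) (dehomogenize (unitLift y)) := by
        simp only [dehomogenize_unitLift]
    _ ⊆ dehomogenize '' segment ℝ (unitLift x) (unitLift y) :=
        segment_dehomogenize_subset (unitLift_snd_pos x) (unitLift_snd_pos y)
    _ ⊆ dehomogenize '' segment ℝ (unitLift x) (M (unitLift x, unitLift y)) ∪
          dehomogenize '' segment ℝ (unitLift y) (M (unitLift y, unitLift x)) := by
        rw [← image_union, hswap, segment_symm ℝ (unitLift y)]
        exact image_mono (segment_subset_union_segment hmem)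
    _ ⊆ _ := union_subset_union (hhalf x y hy) (hhalf y x hx)

theorem isCompactlyConvex [FiniteDimensional ℝ E]
    (hM : IsSymmetricSelection (homogenization C) M) (hC : Convex ℝ C) :
    IsCompactlyConvex C := by
  refine ⟨hC, ?_⟩
  rcases C.eq_empty_or_nonempty with rfl | ⟨x₀, hx₀⟩
  · exact ⟨isEmptyElim, continuous_of_const isEmptyElim, isEmptyElim⟩
  have : CompactSpace (unitDirections C) := isCompact_iff_compactSpace.1 isCompact_unitDirections
  have : Nonempty (unitDirections C) := ⟨⟨_, unitLift_mem_unitDirections hC hx₀⟩⟩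
  let G : C → Icc (0 : ℝ) 1 × unitDirections C → C := fun x z =>
    ⟨fan M x (z.1, z.2),
      ((mem_homogenization_iff hC).1 (hM.lineMap_mem_homogenization hC x.2 z.2.2 z.1.2)).2⟩
  have hG : Continuous (Function.uncurry G) := (hM.continuous_fan hC).subtype_mk _
  refine ⟨fun x => (⊤ : TopologicalSpace.NonemptyCompacts _).map (G x) (by fun_prop),
    continuous_const.nonemptyCompacts_map' hG, fun x y => ?_⟩
  have hfan : ∀ x : C, fan M x '' (Icc 0 1 ×ˢ unitDirections C) ⊆
      Subtype.val '' (G x '' univ) := by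
    rintro x _ ⟨⟨t, v⟩, ⟨ht, hv⟩, rfl⟩
    exact ⟨_, ⟨(⟨t, ht⟩, ⟨v, hv⟩), trivial, rfl⟩, rfl⟩
  simp only [TopologicalSpace.NonemptyCompacts.coe_map, TopologicalSpace.NonemptyCompacts.coe_top]
  exact (hM.segment_subset_fan hC x.2 y.2).trans (union_subset_union (hfan x) (hfan y))

end IsSymmetricSelection

end Homogenization

theorem theorem1_general {E : Type*} [NormedAddCommGroup E] [NormedSpace ℝ E]
    [FiniteDimensional ℝ E] (hE : Module.finrank ℝ E ≤ 2) {C : Set E} (hC : Convex ℝ C) :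
    IsCompactlyConvex C := by
  have hcone : Module.finrank ℝ (E × ℝ) ≤ 3 := by
    rw [Module.finrank_prod, Module.finrank_self]
    exact Nat.succ_le_succ hE
  obtain ⟨M, hM⟩ := exists_isSymmetricSelection (K := homogenization C) hcone
  exact hM.isCompactlyConvex hC

theorem theorem1 (C : Set (EuclideanSpace ℝ (Fin 2))) (hC : Convex ℝ C) :
    IsCompactlyConvex C :=
  theorem1_general (by simp) hC
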